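/- Fix $C$ event types, nonnegative measurable kernels $g_1,\dots,g_L$ on $[0,\infty)$ and nonnegative coefficients $A=(a_{cc'l})$, and let $\phi_{cc'}(t)=\sum_{l=1}^{L}a_{cc'l}\,g_l(t)$ be the impact functions. For $\mu\in[0,\infty)^C$, a $C$-variate counting process $N(t)=(N_c(t))_{c=1}^{C}$, $t\ge 0$, $N(0)=0$ (integer-valued, nondecreasing, right-continuous paths), on a probability space is called a Hawkes process, $N\sim HP(\mu,A)$, if almost surely no two of its events happen at the same time and its conditional intensity with respect to its own history $\mathcal H_t=\sigma(N(s):s\le t)$ is $$\lambda_c(t)=\mu_c+\sum_{(t_i,c_i):\,t_i<t}\phi_{cc_i}(t-t_i),\qquad c=1,\dots,C,$$ the sum being over the events $(t_i,c_i)$ (time, type) of $N$ before $t$. Here $(\lambda_c)_{c=1}^{C}$ is called the conditional intensity of $N$ with respect to a filtration $(\mathcal F_t)$ (informally $\lambda_c(t)\,dt=\mathbb E[dN_c(t)\mid\mathcal F_{t-}]$) if $N$ is adapted, each $\lambda_c$ is predictable and almost surely integrable on bounded intervals, and $\mathbb E\int_0^\infty H(t)\,dN_c(t)=\mathbb E\int_0^\infty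 H(t)\lambda_c(t)\,dt$ for every $c$ and every nonnegative $(\mathcal F_t)$-predictable process $H$. Theorem. Let $N^1,\dots,N^M$ be independent processes with $N^m\sim HP(\mu^m,A)$ for $m=1,\dots,M$ (the same impact functions for all $m$). Then their superposition $N(t)=\sum_{m=1}^{M}N^m(t)$ is a single Hawkes process, $N\sim HP\bigl(\sum_{m=1}^{M}\mu^m,A\bigr)$. Moreover, the conditional intensity of $N$ with respect to the joint history $\sigma(N^m(s):s\le t,\ m=1,\dots,M)$ is the sum $\sum_{m=1}^{M}\lambda^m_c(t)$ of the individual conditional intensities. -/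

import Mathlib

open MeasureTheory ProbabilityTheory Set
open scoped NNReal ENNReal

noncomputable section

namespace HawkesProcess

/-- Lebesgue measure on the time axis `[0, ∞)`. -/
def lebesgue : Measure ℝ≥0 := (volume : Measure ℝ).comap ((↑) : ℝ≥0 → ℝ)

/-- A multivariate counting process on `Ω` with `C` types of events (entities):
`count c t ω` is the number of events of type `c` up to time `t`.  Every path starts at `0`, is
integer-valued, nondecreasing and right-continuous. -/
structure CountingProcess (Ω : Type*) [MeasurableSpace Ω] (C : ℕ) where
  count : Fin C → ℝ≥0 → Ω → ℕ
  measurable_count : ∀ c t, Measurable (count c t)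
  count_zero : ∀ c ω, count c 0 ω = 0
  mono_count : ∀ c ω, Monotone fun t => count c t ω
  right_continuous_count : ∀ c ω t, ContinuousWithinAt (fun s => count c s ω) (Ici t) t

namespace CountingProcess

variable {Ω : Type*} {mΩ : MeasurableSpace Ω} {C : ℕ}

/-- The path of type `c` as a Stieltjes function. -/
def path (N : CountingProcess Ω C) (c : Fin C) (ω : Ω) : StieltjesFunction ℝ≥0 where
  toFun t := (N.count c t ω : ℝ)
  mono' := fun _ _ h => Nat.cast_le.2 (N.mono_count c ω h)
  right_continuous' := fun t =>
    (continuous_of_discreteTopology (f := fun n : ℕ => (n : ℝ))).continuousAt.comp_continuousWithinAt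
      (N.right_continuous_count c ω t)

/-- The measure `dN_c(ω)`: the sum of the unit point masses at the events of type `c`, so that
`∫⁻ s, f s ∂(N.events c ω)` is the sum of `f` over the times of these events. -/
def events (N : CountingProcess Ω C) (c : Fin C) (ω : Ω) : Measure ℝ≥0 :=
  (N.path c ω).measure

/-- Almost surely no two events, of the same type or of different types, happen at the same
time. -/
def IsSimple (N : CountingProcess Ω C) (P : Measure Ω) : Prop :=
  ∀ᵐ ω ∂P, ∀ t : ℝ≥0, ∑ c, N.events c ω {t} ≤ 1

/-- The history of the process: `history t` is the σ-algebra generated by all the `N_c(s)`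
with `s ≤ t`. -/
def history (N : CountingProcess Ω C) : Filtration ℝ≥0 mΩ :=
  Filtration.natural (fun t ω c => N.count c t ω)
    fun t => (measurable_pi_lambda _ fun c => N.measurable_count c t).stronglyMeasurable

/-- The superposition: the sum of the counting processes. -/
def superposition {M : ℕ} (N : Fin M → CountingProcess Ω C) : CountingProcess Ω C where
  count c t ω := ∑ m, (N m).count c t ω
  measurable_count c t :=
    Finset.measurable_sum Finset.univ fun m _ => (N m).measurable_count c t
  count_zero c ω := Finset.sum_eq_zero fun m _ => (N m).count_zero c ω
  mono_count c ω := fun _ _ h => Finset.sum_le_sum fun m _ => (N m).mono_count c ω h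
  right_continuous_count c ω t :=
    tendsto_finsetSum Finset.univ fun m _ => (N m).right_continuous_count c ω t

/-- `lam` is the conditional intensity of `N` with respect to the filtration `F` (informally,
`E[dN_c(t) | F_{t-}] = lam c t dt`): the process `N` is `F`-adapted, `lam` is `F`-predictable and
almost surely integrable on bounded intervals, and
`E ∫ H dN_c = E ∫ H(t) lam c t dt` for every nonnegative `F`-predictable process `H`. -/
structure HasIntensity (N : CountingProcess Ω C) (P : Measure Ω)
    (F : Filtration ℝ≥0 mΩ) (lam : Fin C → ℝ≥0 → Ω → ℝ≥0∞) : Prop where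
  adapted : ∀ c t, Measurable[F t] (N.count c t)
  predictable : ∀ c, Measurable[F.predictable] fun p : ℝ≥0 × Ω => lam c p.1 p.2
  locally_integrable : ∀ c, ∀ᵐ ω ∂P, ∀ t : ℝ≥0, ∫⁻ s in Iic t, lam c s ω ∂lebesgue < ∞
  compensation : ∀ c, ∀ H : ℝ≥0 × Ω → ℝ≥0∞, Measurable[F.predictable] H →
    ∫⁻ ω, ∫⁻ s, H (s, ω) ∂(N.events c ω) ∂P =
      ∫⁻ ω, ∫⁻ s, H (s, ω) * lam c s ω ∂lebesgue ∂P

end CountingProcess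

variable {Ω : Type*} {mΩ : MeasurableSpace Ω} {C L : ℕ}

/-- The impact function `φ_{cc'}(t) = ∑ l, a_{cc'l} g_l(t)` of type `c'` on type `c`. -/
def impact (g : Fin L → ℝ≥0 → ℝ≥0) (A : Fin C → Fin C → Fin L → ℝ≥0) (c c' : Fin C)
    (t : ℝ≥0) : ℝ≥0 :=
  ∑ l, A c c' l * g l t

/-- The Hawkes intensity `μ_c + ∑ φ_{cc_i}(t - t_i)`, the sum being over all the events
`(t_i, c_i)` of `N` with `t_i < t`. -/
def intensity (g : Fin L → ℝ≥0 → ℝ≥0) (μ : Fin C → ℝ≥0) (A : Fin C → Fin C → Fin L → ℝ≥0)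
    (N : CountingProcess Ω C) (c : Fin C) (t : ℝ≥0) (ω : Ω) : ℝ≥0∞ :=
  μ c + ∑ c', ∫⁻ s in Iio t, (impact g A c c' (t - s) : ℝ≥0∞) ∂(N.events c' ω)

/-- `N ~ HP(μ, A)` (with the kernels `g`): `N` has no simultaneous events, and its conditional
intensity with respect to its own history is the Hawkes intensity. -/
structure IsHawkes (P : Measure Ω) (g : Fin L → ℝ≥0 → ℝ≥0) (μ : Fin C → ℝ≥0)
    (A : Fin C → Fin C → Fin L → ℝ≥0) (N : CountingProcess Ω C) : Prop where
  simple : N.IsSimple P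
  hasIntensity : N.HasIntensity P N.history (intensity g μ A N)

end HawkesProcess

end

/-! Adjoining to the history of `N m`, already at time 0, the whole paths of the other processes
does not change its intensity, because they are independent of it. On sets `D ∩ Prod.snd ⁻¹' E`,
with `D` predictable for `N m` and `E` an event of the others, independence factors the probability
of `E` out of both sides of the compensation formula. These sets form a π-system generating the
enlarged predictable σ-algebra, and uniqueness of measures extends the formula to all integrands
there (`lintegral_compensation_of_indep`). Expected counts may be infinite, so uniqueness is applied
on the predictable sets where fewer than `n` events have occurred; simplicity bounds their Campbell
mass by `n + 1`.

Two consequences follow. Processes predictable for the joint history are admissible integrands for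
every `m`, and summing the formulas gives the intensity of the superposition
(`hasIntensity_superposition`). The jump of `N k` at time `t` is also admissible against `N m`; it
vanishes for Lebesgue-almost every `t`, so common jumps almost surely do not occur
(`ae_events_singleton_eq_zero_or`).

Since the impact functions are shared and the Hawkes intensity is additive in `μ` and the events,
the summed intensity is the Hawkes intensity of the superposition. It depends only on that process's
own past, so it stays the intensity for the smaller history (`HasIntensity.mono`). -/

noncomputable section

namespace HawkesProcess

/-! ### Measurable families of locally finite measures on the time axis -/

section Kernels

variable {α : Type*} {mα : MeasurableSpace α}

/-- A kernel consisting of finite measures is s-finite, even if their masses are unbounded. -/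
theorem isSFiniteKernel_of_isFiniteMeasure {β : Type*} {mβ : MeasurableSpace β} (κ : Kernel α β)
    [∀ a, IsFiniteMeasure (κ a)] : IsSFiniteKernel κ := by
  -- Slice the parameter space by the integer part of the total mass: on slice `k` the mass is at
  -- most `k + 1`.
  have hm : Measurable fun a => ⌊(κ a univ).toReal⌋₊ :=
    Nat.measurable_floor.comp (κ.measurable_coe MeasurableSet.univ).ennreal_toReal
  have hs : ∀ k : ℕ, MeasurableSet {a | ⌊(κ a univ).toReal⌋₊ = k} := fun k =>
    hm (measurableSet_singleton k)
  classical
  refine ⟨⟨fun k => Kernel.piecewise (hs k) κ 0, fun k => ⟨⟨k + 1, by finiteness, fun a => ?_⟩⟩, ?_⟩⟩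
  · rw [Kernel.piecewise_apply]
    split_ifs with h
    · have h1 := (Nat.lt_floor_add_one (κ a univ).toReal).le
      rw [show ⌊(κ a univ).toReal⌋₊ = k from h] at h1
      rw [← ENNReal.ofReal_toReal (measure_ne_top (κ a) univ)]
      refine (ENNReal.ofReal_le_ofReal h1).trans_eq ?_
      rw [ENNReal.ofReal_add (by positivity) zero_le_one]
      simp
    · simp
  · ext a s hs'
    rw [Kernel.sum_apply' _ _ hs']
    simp only [Kernel.piecewise_apply', mem_ofPred_eq, zero_apply, Measure.coe_zero,
      Pi.zero_apply]
    rw [tsum_eq_single (⌊(κ a univ).toReal⌋₊) (fun b hb => if_neg (Ne.symm hb)), if_pos rfl]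

variable {ν : α → Measure ℝ≥0}

/-- The total mass may be infinite, so the π-system argument is run on the finite restrictions to
`Iic n`, followed by a monotone limit. -/
theorem measurable_measure_of_measurable_Iic (hfin : ∀ a t, ν a (Iic t) < ∞)
    (hν : ∀ t, Measurable fun a => ν a (Iic t)) : Measurable ν := by
  have hr : ∀ n : ℕ, Measurable fun a => (ν a).restrict (Iic (n : ℝ≥0)) := fun n => by
    have : ∀ a, IsFiniteMeasure ((ν a).restrict (Iic (n : ℝ≥0))) := fun a =>
      ⟨by simpa using hfin a n⟩
    refine Measurable.measure_of_isPiSystem (S := range Iic) (borel_eq_generateFrom_Iic ℝ≥0 ▸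
      BorelSpace.measurable_eq) isPiSystem_Iic ?_ ?_
    · rintro _ ⟨t, rfl⟩
      simp_rw [Measure.restrict_apply measurableSet_Iic, Iic_inter_Iic]
      exact hν _
    · simp_rw [Measure.restrict_apply MeasurableSet.univ, univ_inter]
      exact hν _
  refine Measure.measurable_of_measurable_coe _ fun s hs => ?_
  have h : ∀ a, ν a s = ⨆ n : ℕ, (ν a).restrict (Iic (n : ℝ≥0)) s := fun a => by
    simp_rw [Measure.restrict_apply hs]
    rw [← Monotone.measure_iUnion, ← inter_iUnion]
    · congr 1
      refine (inter_eq_left.2 fun x _ => mem_iUnion.2 ?_).symm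
      exact exists_nat_ge x
    · intro m n hmn
      exact inter_subset_inter_right _ (Iic_subset_Iic.2 (Nat.cast_le.2 hmn))
  simp_rw [h]
  exact Measurable.iSup fun n => (Measure.measurable_coe hs).comp (hr n)

/-- The kernel of a family of measures that are finite on bounded intervals. -/
def kernelOfIic (hfin : ∀ a t, ν a (Iic t) < ∞)
    (hν : ∀ t, Measurable fun a => ν a (Iic t)) : Kernel α ℝ≥0 :=
  ⟨ν, measurable_measure_of_measurable_Iic hfin hν⟩

theorem isSFiniteKernel_kernelOfIic (hfin : ∀ a t, ν a (Iic t) < ∞)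
    (hν : ∀ t, Measurable fun a => ν a (Iic t)) : IsSFiniteKernel (kernelOfIic hfin hν) := by
  set S : ℕ → Set ℝ≥0 := disjointed fun n : ℕ => Iic (n : ℝ≥0)
  have hS : ∀ n, MeasurableSet (S n) := MeasurableSet.disjointed fun n => measurableSet_Iic
  have h : kernelOfIic hfin hν = Kernel.sum fun n => (kernelOfIic hfin hν).restrict (hS n) := by
    refine Kernel.ext fun a => ?_
    rw [Kernel.sum_apply]
    simp_rw [Kernel.restrict_apply]
    rw [← Measure.restrict_iUnion (disjoint_disjointed _) hS, iUnion_disjointed,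
      show (⋃ n : ℕ, Iic (n : ℝ≥0)) = univ from iUnion_eq_univ_iff.2 fun x => exists_nat_ge x,
      Measure.restrict_univ]
  suffices ∀ n, IsSFiniteKernel ((kernelOfIic hfin hν).restrict (hS n)) by
    rw [h]
    infer_instance
  intro n
  have : ∀ a, IsFiniteMeasure ((kernelOfIic hfin hν).restrict (hS n) a) := fun a => ⟨by
    rw [Kernel.restrict_apply, Measure.restrict_apply MeasurableSet.univ, univ_inter]
    exact (measure_mono (disjointed_subset _ _)).trans_lt (hfin a n)⟩
  exact isSFiniteKernel_of_isFiniteMeasure _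

theorem measurable_lintegral_of_measurable_Iic (hfin : ∀ a t, ν a (Iic t) < ∞)
    (hν : ∀ t, Measurable fun a => ν a (Iic t)) {f : α → ℝ≥0 → ℝ≥0∞}
    (hf : Measurable (Function.uncurry f)) : Measurable fun a => ∫⁻ s, f a s ∂(ν a) :=
  have := isSFiniteKernel_kernelOfIic hfin hν
  Measurable.lintegral_kernel_prod_right (κ := kernelOfIic hfin hν) hf

end Kernels

theorem sigmaFinite_lebesgue : SigmaFinite lebesgue := by
  have : IsFiniteMeasureOnCompacts lebesgue :=
    IsFiniteMeasureOnCompacts.comap' volume NNReal.continuous_coe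
      (MeasurableEmbedding.subtype_coe measurableSet_Ici)
  infer_instance

theorem lebesgue_eq_zero_of_countable {s : Set ℝ≥0} (hs : s.Countable) : lebesgue s = 0 := by
  refine ((MeasurableEmbedding.subtype_coe (s := {x : ℝ | 0 ≤ x}) measurableSet_Ici).comap_apply
    volume s).trans ?_
  exact (hs.image _).measure_zero _

/-! ### Predictable σ-algebras and enlargement of filtrations -/

section Predictable

variable {Ω : Type*} {mΩ : MeasurableSpace Ω} {F F' : Filtration ℝ≥0 mΩ}
  {H K : MeasurableSpace Ω}

theorem comap_fst_le_predictable (F : Filtration ℝ≥0 mΩ) :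
    NNReal.measurableSpace.comap Prod.fst ≤ F.predictable := by
  rw [← measurable_iff_comap_le]
  refine measurable_of_Ioi fun a => ?_
  rw [← prod_univ]
  exact measurableSet_predictable_Ioi_prod MeasurableSet.univ

theorem predictable_le_prod (hF : ∀ t, F t ≤ H) :
    F.predictable ≤ NNReal.measurableSpace.prod H :=
  measurableSpace_le_predictable_of_measurableSet
    (fun A hA => (measurableSet_singleton _).prod (hF _ A hA))
    (fun i A hA => measurableSet_Ioi.prod (hF i A hA))

theorem predictable_le_measurableSpace_prod (F : Filtration ℝ≥0 mΩ) :
    F.predictable ≤ NNReal.measurableSpace.prod mΩ :=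
  predictable_le_prod F.le

/-- Measurability of the rectangles over a fixed set of times passes to the join of σ-algebras. -/
theorem measurableSet_prod_of_sup {m : MeasurableSpace (ℝ≥0 × Ω)} {m₁ m₂ : MeasurableSpace Ω}
    {T : Set ℝ≥0} (h₁ : ∀ A, MeasurableSet[m₁] A → MeasurableSet[m] (T ×ˢ A))
    (h₂ : ∀ A, MeasurableSet[m₂] A → MeasurableSet[m] (T ×ˢ A)) {A : Set Ω}
    (hA : MeasurableSet[m₁ ⊔ m₂] A) : MeasurableSet[m] (T ×ˢ A) := by
  replace hA := MeasurableSpace.measurableSet_sup.1 hA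
  induction hA with
  | basic A hA => exact hA.elim (h₁ A) (h₂ A)
  | empty => simp
  | compl A _ ih =>
    have : T ×ˢ Aᶜ = (T ×ˢ univ) \ (T ×ˢ A) := by
      ext ⟨s, ω⟩; simp only [mem_prod, mem_compl_iff, mem_sdiff, mem_univ]; tauto
    rw [this]
    exact (h₁ univ MeasurableSet.univ).diff ih
  | iUnion f _ ih =>
    rw [prod_iUnion]
    exact MeasurableSet.iUnion ih

/-- It suffices to treat the generating rectangles. With the time set fixed, the base events may be
taken from `F t` or from `K` separately; for those in `K`, the time set and the event are measurable
independently of each other. -/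
theorem predictable_le_sup (h : ∀ t, F' t ≤ F t ⊔ K) :
    F'.predictable ≤ F.predictable ⊔ K.comap Prod.snd := by
  have hK : ∀ (T : Set ℝ≥0), MeasurableSet T → ∀ A, MeasurableSet[K] A →
      MeasurableSet[F.predictable ⊔ K.comap Prod.snd] (T ×ˢ A) := fun T hT A hA => by
    rw [prod_eq]
    refine MeasurableSet.inter ?_ ?_
    · exact ((comap_fst_le_predictable F).trans le_sup_left) _ ⟨T, hT, rfl⟩
    · exact (le_sup_right : _ ≤ F.predictable ⊔ K.comap Prod.snd) _ ⟨A, hA, rfl⟩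
  refine measurableSpace_le_predictable_of_measurableSet (fun A hA => ?_) (fun i A hA => ?_)
  · refine measurableSet_prod_of_sup (fun B hB => ?_) (hK _ (measurableSet_singleton _)) (h _ A hA)
    exact (le_sup_left : F.predictable ≤ _) _ (measurableSet_predictable_singleton_bot_prod hB)
  · refine measurableSet_prod_of_sup (fun B hB => ?_) (hK _ measurableSet_Ioi) (h _ A hA)
    exact (le_sup_left : F.predictable ≤ _) _ (measurableSet_predictable_Ioi_prod hB)

theorem predictable_mono (h : F' ≤ F) : F'.predictable ≤ F.predictable :=
  measurableSpace_le_predictable_of_measurableSet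
    (fun A hA => measurableSet_predictable_singleton_bot_prod (h _ A hA))
    (fun i A hA => measurableSet_predictable_Ioi_prod (h i A hA))

/-- Once `K` is known from time 0, a process jointly measurable in time and `K` is an admissible
integrand even if it looks into the future. -/
theorem prod_le_predictable_sup (F : Filtration ℝ≥0 mΩ) (K : MeasurableSpace Ω) :
    NNReal.measurableSpace.prod K ≤ F.predictable ⊔ K.comap Prod.snd :=
  sup_le_sup_right (comap_fst_le_predictable F) _

theorem measurable_predictable_indicator {f : Ω → ℝ≥0∞} {t : ℝ≥0} (hf : Measurable[F t] f) :
    Measurable[F.predictable] ((Ioi t ×ˢ univ).indicator fun p : ℝ≥0 × Ω => f p.2) := by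
  refine measurable_of_Ioi fun a => ?_
  have : (Ioi t ×ˢ univ).indicator (fun p : ℝ≥0 × Ω => f p.2) ⁻¹' Ioi a =
      Ioi t ×ˢ (f ⁻¹' Ioi a) := by
    ext ⟨s, ω⟩
    simp only [mem_preimage, indicator_apply, mem_prod, mem_univ, and_true, mem_Ioi]
    split_ifs with h <;> simp [h]
  rw [this]
  exact measurableSet_predictable_Ioi_prod (hf measurableSet_Ioi)

end Predictable

/-! ### Event measures and their predictability -/

namespace CountingProcess

variable {Ω : Type*} {mΩ : MeasurableSpace Ω} {C : ℕ} (N : CountingProcess Ω C)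

instance isLocallyFiniteMeasure_events (c : Fin C) (ω : Ω) :
    IsLocallyFiniteMeasure (N.events c ω) :=
  inferInstanceAs (IsLocallyFiniteMeasure (N.path c ω).measure)

theorem events_Iic (c : Fin C) (ω : Ω) (t : ℝ≥0) :
    N.events c ω (Iic t) = (N.count c t ω : ℝ≥0∞) := by
  have h : Iic t = {0} ∪ Ioc 0 t := by
    ext x
    simp only [mem_Iic, mem_union, mem_singleton_iff, mem_Ioc]
    constructor
    · intro hx
      exact (eq_or_ne x 0).imp_right fun h0 => ⟨pos_iff_ne_zero.2 h0, hx⟩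
    · rintro (rfl | hx)
      exacts [zero_le, hx.2]
  -- At the least time the left limit defaults to the value, so the Stieltjes measure has no atom at
  -- 0.
  have h0 : Function.leftLim (N.path c ω) 0 = N.path c ω 0 := by
    refine leftLim_eq_of_eq_bot _ ?_
    rw [show Iio (0 : ℝ≥0) = ∅ from Iio_bot, nhdsWithin_empty]
  have hp : N.path c ω 0 = 0 := by
    change (N.count c 0 ω : ℝ) = 0
    rw [N.count_zero, Nat.cast_zero]
  rw [h, events, measure_union (by simp) measurableSet_Ioc, StieltjesFunction.measure_singleton,
    StieltjesFunction.measure_Ioc, h0, hp]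
  simp only [sub_self, ENNReal.ofReal_zero, sub_zero, zero_add]
  exact ENNReal.ofReal_natCast _

theorem events_Iic_lt_top (c : Fin C) (ω : Ω) (t : ℝ≥0) : N.events c ω (Iic t) < ∞ := by
  simp [events_Iic]

theorem events_superposition {M : ℕ} (N : Fin M → CountingProcess Ω C) (c : Fin C) (ω : Ω) :
    (superposition N).events c ω = ∑ m, (N m).events c ω := by
  have h : (superposition N).path c ω = ∑ m, (N m).path c ω := by
    ext t
    have hs : ∀ s : Finset (Fin M), (∑ m ∈ s, (N m).path c ω) t = ∑ m ∈ s, ((N m).count c t ω : ℝ) := by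
      intro s
      classical
      induction s using Finset.induction_on with
      | empty => rfl
      | insert a s ha ih =>
        rw [Finset.sum_insert ha, Finset.sum_insert ha, StieltjesFunction.add_apply, ih]
        rfl
    rw [hs]
    exact Nat.cast_sum Finset.univ fun m => (N m).count c t ω
  have hs : ∀ s : Finset (Fin M), (∑ m ∈ s, (N m).path c ω).measure =
      ∑ m ∈ s, (N m).events c ω := by
    intro s
    classical
    induction s using Finset.induction_on with
    | empty => exact StieltjesFunction.measure_zero
    | insert a s ha ih =>
      rw [Finset.sum_insert ha, Finset.sum_insert ha, StieltjesFunction.measure_add, ih]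
      rfl
  rw [events, h, hs]

theorem measurable_count_history (c : Fin C) {s t : ℝ≥0} (hst : s ≤ t) :
    Measurable[N.history t] (N.count c s) := by
  have h : Measurable[N.history t] fun ω c => N.count c s ω := by
    rw [measurable_iff_comap_le]
    exact le_iSup₂_of_le (f := fun j (_ : j ≤ t) =>
      MeasurableSpace.comap (fun ω c => N.count c j ω) MeasurableSpace.pi) s hst le_rfl
  exact (measurable_pi_apply c).comp h

/-- Any σ-algebra that makes all counts up to time `t` measurable contains the history. -/
theorem history_le {t : ℝ≥0} {m : MeasurableSpace Ω}
    (h : ∀ c, ∀ s ≤ t, Measurable[m] (@count Ω mΩ C N c s)) :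
    history (mΩ := mΩ) N t ≤ m := by
  refine iSup₂_le fun s hs => ?_
  rw [← measurable_iff_comap_le]
  exact @measurable_pi_lambda _ _ _ m _ _ fun c => h c s hs

/-- Integrals against the events are measurable for every σ-algebra that makes the counts
measurable. -/
theorem measurable_lintegral_events {α : Type*} [MeasurableSpace α] {j : α → Ω} {c : Fin C}
    (hN : ∀ t, Measurable fun a => N.count c t (j a)) {f : α → ℝ≥0 → ℝ≥0∞}
    (hf : Measurable (Function.uncurry f)) :
    Measurable fun a => ∫⁻ s, f a s ∂(N.events c (j a)) :=
  measurable_lintegral_of_measurable_Iic (fun a => N.events_Iic_lt_top c (j a))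
    (fun t => by
      simp_rw [events_Iic]
      exact (measurable_of_countable ((↑) : ℕ → ℝ≥0∞)).comp (hN t)) hf

/-- Writes the mass strictly before `t` through counts at countably many times `d n < t`. Each term
is a left-open predictable step, which is why strictness in `Iio` yields predictability. -/
theorem events_Iic_inter_Iio (c : Fin C) (ω : Ω) (a t : ℝ≥0) :
    N.events c ω (Iic a ∩ Iio t) = ⨆ n : ℕ, (Ioi (TopologicalSpace.denseSeq ℝ≥0 n) ×ˢ univ).indicator
      (fun p : ℝ≥0 × Ω => (N.count c (min a (TopologicalSpace.denseSeq ℝ≥0 n)) p.2 : ℝ≥0∞))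
        (t, ω) := by
  set d := TopologicalSpace.denseSeq ℝ≥0
  set S : ℕ → Set ℝ≥0 := fun n => if d n < t then Iic (min a (d n)) else ∅ with hS
  have hU : Iic a ∩ Iio t = ⋃ n, S n := by
    ext x
    simp only [mem_inter_iff, mem_Iic, mem_Iio, mem_iUnion, hS]
    constructor
    · rintro ⟨hxa, hxt⟩
      obtain ⟨_, ⟨n, rfl⟩, hn⟩ := (TopologicalSpace.denseRange_denseSeq ℝ≥0).exists_between hxt
      exact ⟨n, by rw [if_pos hn.2]; exact le_min hxa hn.1.le⟩
    · rintro ⟨n, hn⟩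
      split_ifs at hn with h
      · exact ⟨hn.trans (min_le_left _ _), (hn.trans (min_le_right _ _)).trans_lt h⟩
      · exact hn.elim
  have hd : Directed (· ⊆ ·) S := by
    intro i j
    by_cases hi : d i < t
    · by_cases hj : d j < t
      · rcases le_total (d i) (d j) with h | h
        · refine ⟨j, ?_, Subset.rfl⟩
          simp only [hS, if_pos hi, if_pos hj]
          exact Iic_subset_Iic.2 (min_le_min_left _ h)
        · refine ⟨i, Subset.rfl, ?_⟩
          simp only [hS, if_pos hi, if_pos hj]
          exact Iic_subset_Iic.2 (min_le_min_left _ h)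
      · exact ⟨i, Subset.rfl, by simp [hS, hj]⟩
    · exact ⟨j, by simp [hS, hi], Subset.rfl⟩
  rw [hU, hd.measure_iUnion]
  congr 1
  ext n
  simp only [hS, indicator_apply, mem_prod, mem_Ioi, mem_univ, and_true]
  split_ifs
  · exact N.events_Iic c ω _
  · exact measure_empty

theorem measurable_events_Iic_inter_Iio {F : Filtration ℝ≥0 mΩ} {c : Fin C}
    (hN : ∀ t, Measurable[F t] (N.count c t)) (a : ℝ≥0) :
    Measurable[F.predictable] fun p : ℝ≥0 × Ω => N.events c p.2 (Iic a ∩ Iio p.1) := by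
  simp_rw [events_Iic_inter_Iio]
  refine Measurable.iSup fun n => measurable_predictable_indicator (F := F)
    (f := fun ω => (N.count c (min a (TopologicalSpace.denseSeq ℝ≥0 n)) ω : ℝ≥0∞)) ?_
  exact (measurable_of_countable ((↑) : ℕ → ℝ≥0∞)).comp
    ((hN _).mono (F.mono (min_le_right _ _)) le_rfl)

/-- Integrals over the events strictly before the present time are predictable. -/
theorem measurable_predictable_lintegral_Iio {F : Filtration ℝ≥0 mΩ} {c : Fin C}
    (hN : ∀ t, Measurable[F t] (N.count c t)) {φ : ℝ≥0 → ℝ≥0 → ℝ≥0∞}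
    (hφ : Measurable (Function.uncurry φ)) :
    Measurable[F.predictable]
      fun p : ℝ≥0 × Ω => ∫⁻ s in Iio p.1, φ p.1 s ∂(N.events c p.2) := by
  let := F.predictable
  refine measurable_lintegral_of_measurable_Iic
    (ν := fun p : ℝ≥0 × Ω => (N.events c p.2).restrict (Iio p.1)) (fun p t => ?_) (fun t => ?_)
    (f := fun p s => φ p.1 s) ?_
  · exact (Measure.restrict_apply_le _ _).trans_lt (N.events_Iic_lt_top c p.2 t)
  · simp_rw [Measure.restrict_apply measurableSet_Iic]
    exact N.measurable_events_Iic_inter_Iio hN t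
  · have hfst : @Measurable _ _ F.predictable _ (Prod.fst : ℝ≥0 × Ω → ℝ≥0) :=
      measurable_iff_comap_le.2 (comap_fst_le_predictable F)
    exact hφ.comp ((hfst.comp measurable_fst).prodMk measurable_snd)

end CountingProcess

/-! ### The Hawkes intensity: predictability and additivity -/

open CountingProcess

variable {Ω : Type*} {mΩ : MeasurableSpace Ω} {C L M : ℕ} {g : Fin L → ℝ≥0 → ℝ≥0}

theorem measurable_impact (hg : ∀ l, Measurable (g l)) (A : Fin C → Fin C → Fin L → ℝ≥0)
    (c c' : Fin C) : Measurable (impact g A c c') :=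
  Finset.measurable_sum Finset.univ fun l _ => (hg l).const_mul _

theorem measurable_predictable_intensity (hg : ∀ l, Measurable (g l)) (μ : Fin C → ℝ≥0)
    (A : Fin C → Fin C → Fin L → ℝ≥0) (N : CountingProcess Ω C) {F : Filtration ℝ≥0 mΩ}
    (hN : ∀ c t, Measurable[F t] (N.count c t)) (c : Fin C) :
    Measurable[F.predictable] fun p : ℝ≥0 × Ω => intensity g μ A N c p.1 p.2 := by
  let := F.predictable
  unfold intensity
  refine Measurable.const_add ?_ _
  refine Finset.measurable_sum Finset.univ fun c' _ => ?_
  refine N.measurable_predictable_lintegral_Iio (hN c')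
    (φ := fun t s => (impact g A c c' (t - s) : ℝ≥0∞)) ?_
  exact ((measurable_impact hg A c c').comp (measurable_fst.sub measurable_snd)).coe_nnreal_ennreal

theorem intensity_superposition (g : Fin L → ℝ≥0 → ℝ≥0) (μ : Fin M → Fin C → ℝ≥0)
    (A : Fin C → Fin C → Fin L → ℝ≥0) (N : Fin M → CountingProcess Ω C) (c : Fin C) (t : ℝ≥0)
    (ω : Ω) : intensity g (fun c => ∑ m, μ m c) A (superposition N) c t ω =
      ∑ m, intensity g (μ m) A (N m) c t ω := by
  simp only [intensity]
  rw [Finset.sum_add_distrib, Finset.sum_comm, ENNReal.ofNNReal_finsetSum Finset.univ fun m : Fin M => μ m c]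
  congr 1
  refine Finset.sum_congr rfl fun c' _ => ?_
  rw [← lintegral_indicator measurableSet_Iio, events_superposition, lintegral_finsetSum_measure]
  exact Finset.sum_congr rfl fun m _ => lintegral_indicator measurableSet_Iio _

/-! ### Compensation under an independent enlargement of the history -/

theorem isPiSystem_inter_measurableSet {α : Type*} (m₁ m₂ : MeasurableSpace α) :
    IsPiSystem {s | ∃ A B, MeasurableSet[m₁] A ∧ MeasurableSet[m₂] B ∧ s = A ∩ B} := by
  rintro _ ⟨A, B, hA, hB, rfl⟩ _ ⟨A', B', hA', hB', rfl⟩ -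
  exact ⟨A ∩ A', B ∩ B', hA.inter hA', hB.inter hB', inter_inter_inter_comm _ _ _ _⟩

theorem sup_eq_generateFrom_inter {α : Type*} (m₁ m₂ : MeasurableSpace α) :
    m₁ ⊔ m₂ = MeasurableSpace.generateFrom
      {s | ∃ A B, MeasurableSet[m₁] A ∧ MeasurableSet[m₂] B ∧ s = A ∩ B} := by
  refine le_antisymm (sup_le (fun A hA => ?_) fun B hB => ?_) (MeasurableSpace.generateFrom_le ?_)
  · exact MeasurableSpace.measurableSet_generateFrom
      ⟨A, univ, hA, @MeasurableSet.univ _ m₂, (inter_univ A).symm⟩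
  · exact MeasurableSpace.measurableSet_generateFrom
      ⟨univ, B, @MeasurableSet.univ _ m₁, hB, (univ_inter B).symm⟩
  · rintro _ ⟨A, B, hA, hB, rfl⟩
    exact MeasurableSet.inter ((le_sup_left : m₁ ≤ m₁ ⊔ m₂) _ hA)
      ((le_sup_right : m₂ ≤ m₁ ⊔ m₂) _ hB)

/-- If `ν` has atoms of mass at most `1`, the times before which its mass is below `n` have total
mass at most `n + 1`. -/
theorem measure_setOf_measure_Iio_lt_le (ν : Measure ℝ≥0) [IsLocallyFiniteMeasure ν]
    (hν : ∀ t, ν {t} ≤ 1) (n : ℕ) : ν {t | ν (Iio t) < n} ≤ n + 1 := by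
  have hm : MeasurableSet {t | ν (Iio t) < n} := by
    refine OrdConnected.measurableSet ⟨fun x _ y hy z hz => ?_⟩
    exact (measure_mono (Iio_subset_Iio hz.2)).trans_lt hy
  -- A nonempty compact subset contains its maximum `x`, so `ν (Iio x) < n` and only the atom at `x`
  -- is added; the full set need not contain its supremum.
  rw [hm.measure_eq_iSup_isCompact]
  refine iSup₂_le fun K hK => iSup_le fun hc => ?_
  rcases K.eq_empty_or_nonempty with rfl | hne
  · simp
  · obtain ⟨x, hx⟩ := hc.exists_isGreatest hne
    calc ν K ≤ ν (Iio x ∪ {x}) := measure_mono fun y hy => by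
          rw [Iio_union_right]; exact hx.2 hy
      _ ≤ ν (Iio x) + ν {x} := measure_union_le _ _
      _ ≤ n + 1 := add_le_add (hK hx.1).le (hν x)

namespace CountingProcess

variable {Ω : Type*} {H K mΩ : MeasurableSpace Ω} {C : ℕ} (N : CountingProcess Ω C)
  {P : Measure Ω} {F : Filtration ℝ≥0 mΩ} {lam : Fin C → ℝ≥0 → Ω → ℝ≥0∞}

theorem IsSimple.events_singleton_le {N : CountingProcess Ω C} (h : N.IsSimple P) (c : Fin C) :
    ∀ᵐ ω ∂P, ∀ t, N.events c ω {t} ≤ 1 := by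
  filter_upwards [h] with ω hω t
  exact (Finset.single_le_sum (f := fun c => N.events c ω {t}) (fun _ _ => zero_le)
    (Finset.mem_univ c)).trans (hω t)

theorem measurable_lintegral_events_swap (c : Fin C) {Z : ℝ≥0 × Ω → ℝ≥0∞} (hZ : Measurable Z) :
    Measurable fun ω => ∫⁻ s, Z (s, ω) ∂(N.events c ω) :=
  N.measurable_lintegral_events (j := id) (N.measurable_count c) (hZ.comp measurable_swap)

theorem measurable_events_Iic (c : Fin C) (t : ℝ≥0) :
    Measurable fun ω => N.events c ω (Iic t) := by
  simp_rw [events_Iic]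
  exact (measurable_of_countable ((↑) : ℕ → ℝ≥0∞)).comp (N.measurable_count c t)

/-- The measure `dN_c(ω) P(dω)`. -/
def campbell (P : Measure Ω) (c : Fin C) : Measure (ℝ≥0 × Ω) :=
  (P ⊗ₘ kernelOfIic (N.events_Iic_lt_top c)
    (N.measurable_events_Iic c)).map Prod.swap

theorem lintegral_campbell [SFinite P] (c : Fin C) {Z : ℝ≥0 × Ω → ℝ≥0∞} (hZ : Measurable Z) :
    ∫⁻ p, Z p ∂(N.campbell P c) = ∫⁻ ω, ∫⁻ s, Z (s, ω) ∂(N.events c ω) ∂P := by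
  have := isSFiniteKernel_kernelOfIic (N.events_Iic_lt_top c) (N.measurable_events_Iic c)
  rw [campbell, lintegral_map hZ measurable_swap,
    Measure.lintegral_compProd (f := fun p => Z p.swap) (hZ.comp measurable_swap)]
  rfl

/-- The measure `l(t, ω) dt P(dω)`. -/
def compensator (P : Measure Ω) (l : ℝ≥0 → Ω → ℝ≥0∞) : Measure (ℝ≥0 × Ω) :=
  (lebesgue.prod P).withDensity fun p => l p.1 p.2

theorem lintegral_compensator [SFinite P] {l : ℝ≥0 → Ω → ℝ≥0∞}
    (hl : Measurable fun p : ℝ≥0 × Ω => l p.1 p.2) {Z : ℝ≥0 × Ω → ℝ≥0∞} (hZ : Measurable Z) :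
    ∫⁻ p, Z p ∂(compensator P l) = ∫⁻ ω, ∫⁻ s, Z (s, ω) * l s ω ∂lebesgue ∂P := by
  have := sigmaFinite_lebesgue
  rw [compensator, lintegral_withDensity_eq_lintegral_mul _ hl hZ,
    lintegral_prod_symm' _ (hl.mul hZ)]
  simp only [Pi.mul_apply, mul_comm]

theorem measurable_lintegral_lebesgue {α : Type*} [MeasurableSpace α] {Z : ℝ≥0 × α → ℝ≥0∞}
    (hZ : Measurable Z) : Measurable fun ω => ∫⁻ s, Z (s, ω) ∂lebesgue :=
  have := sigmaFinite_lebesgue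
  hZ.lintegral_prod_left'

/-- An independent event factors out of both sides of the compensation formula. -/
theorem lintegral_compensation_indicator_of_indep {N : CountingProcess Ω C}
    (hF : ∀ t, F t ≤ H) (hH : H ≤ mΩ) (hK : K ≤ mΩ) (hHK : Indep H K P)
    (hN : N.HasIntensity P F lam) (c : Fin C) {D : Set (ℝ≥0 × Ω)}
    (hD : MeasurableSet[F.predictable] D) {E : Set Ω} (hE : MeasurableSet[K] E) :
    ∫⁻ ω, ∫⁻ s, (D ∩ Prod.snd ⁻¹' E).indicator 1 (s, ω) ∂(N.events c ω) ∂P =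
      ∫⁻ ω, ∫⁻ s, (D ∩ Prod.snd ⁻¹' E).indicator 1 (s, ω) * lam c s ω ∂lebesgue ∂P := by
  have hDi : Measurable[F.predictable] (D.indicator (1 : ℝ≥0 × Ω → ℝ≥0∞)) :=
    (@measurable_const _ _ _ F.predictable 1).indicator hD
  have hEi : Measurable[K] (E.indicator (1 : Ω → ℝ≥0∞)) :=
    (@measurable_const _ _ _ K 1).indicator hE
  have hfac : ∀ s ω, (D ∩ Prod.snd ⁻¹' E).indicator (1 : ℝ≥0 × Ω → ℝ≥0∞) (s, ω) =
      D.indicator 1 (s, ω) * E.indicator 1 ω := fun s ω => by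
    rw [inter_indicator_one]; rfl
  have hle : F.predictable ≤ NNReal.measurableSpace.prod H := predictable_le_prod hF
  have hEt : ∀ ω, E.indicator (1 : Ω → ℝ≥0∞) ω ≠ ∞ := fun ω => by
    by_cases h : ω ∈ E <;> simp [h]
  -- `H` contains every `F t`, so both inner integrals are `H`-measurable and hence independent of
  -- `E`.
  have hX : Measurable[H] fun ω => ∫⁻ s, D.indicator 1 (s, ω) ∂(N.events c ω) :=
    @measurable_lintegral_events Ω mΩ C N Ω H id c
      (fun t => (hN.adapted c t).mono (hF t) le_rfl) _
      ((hDi.mono hle le_rfl).comp (@measurable_swap Ω ℝ≥0 H _))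
  have hY : Measurable[H] fun ω => ∫⁻ s, D.indicator 1 (s, ω) * lam c s ω ∂lebesgue :=
    @measurable_lintegral_lebesgue Ω H _ ((hDi.mul (hN.predictable c)).mono hle le_rfl)
  calc ∫⁻ ω, ∫⁻ s, (D ∩ Prod.snd ⁻¹' E).indicator 1 (s, ω) ∂(N.events c ω) ∂P
      = ∫⁻ ω, (∫⁻ s, D.indicator 1 (s, ω) ∂(N.events c ω)) * E.indicator 1 ω ∂P := by
        refine lintegral_congr fun ω => ?_
        simp_rw [hfac]
        exact lintegral_mul_const' _ _ (hEt ω)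
    _ = (∫⁻ ω, ∫⁻ s, D.indicator 1 (s, ω) ∂(N.events c ω) ∂P) * ∫⁻ ω, E.indicator 1 ω ∂P :=
        lintegral_mul_eq_lintegral_mul_lintegral_of_independent_measurableSpace hH hK hHK hX hEi
    _ = (∫⁻ ω, ∫⁻ s, D.indicator 1 (s, ω) * lam c s ω ∂lebesgue ∂P) *
          ∫⁻ ω, E.indicator 1 ω ∂P := by rw [hN.compensation c _ hDi]
    _ = ∫⁻ ω, (∫⁻ s, D.indicator 1 (s, ω) * lam c s ω ∂lebesgue) * E.indicator 1 ω ∂P :=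
        (lintegral_mul_eq_lintegral_mul_lintegral_of_independent_measurableSpace
          hH hK hHK hY hEi).symm
    _ = ∫⁻ ω, ∫⁻ s, (D ∩ Prod.snd ⁻¹' E).indicator 1 (s, ω) * lam c s ω ∂lebesgue ∂P := by
        refine lintegral_congr fun ω => ?_
        simp_rw [hfac, mul_right_comm]
        exact (lintegral_mul_const' _ _ (hEt ω)).symm

/-- The compensation formula persists when the history is enlarged, at all times, by an
independent σ-algebra. -/
theorem lintegral_compensation_of_indep [IsProbabilityMeasure P] {N : CountingProcess Ω C}
    (hF : ∀ t, F t ≤ H) (hH : H ≤ mΩ) (hK : K ≤ mΩ) (hHK : Indep H K P)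
    (hN : N.HasIntensity P F lam) (hs : N.IsSimple P) (c : Fin C) {Z : ℝ≥0 × Ω → ℝ≥0∞}
    (hZ : Measurable[F.predictable ⊔ K.comap Prod.snd] Z) :
    ∫⁻ ω, ∫⁻ s, Z (s, ω) ∂(N.events c ω) ∂P =
      ∫⁻ ω, ∫⁻ s, Z (s, ω) * lam c s ω ∂lebesgue ∂P := by
  have hFp := predictable_le_measurableSpace_prod F
  have hle : F.predictable ⊔ K.comap Prod.snd ≤ NNReal.measurableSpace.prod mΩ :=
    sup_le hFp ((MeasurableSpace.comap_mono hK).trans le_sup_right)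
  have hl := (hN.predictable c).mono hFp le_rfl
  -- Localization by the number of events strictly before the present; the strict past makes `B n`
  -- predictable.
  set B : ℕ → Set (ℝ≥0 × Ω) := fun n => {p | N.events c p.2 (Iio p.1) < n} with hB
  have hBm : ∀ n, MeasurableSet[F.predictable] (B n) := fun n => by
    have := N.measurable_predictable_lintegral_Iio (hN.adapted c) (φ := fun _ _ => 1)
      measurable_const
    simp only [lintegral_const, one_mul, Measure.restrict_apply_univ] at this
    exact this measurableSet_Iio
  have hBU : ⋃ n, B n = univ := iUnion_eq_univ_iff.2 fun p => by
    refine ENNReal.exists_nat_gt (ne_of_lt ?_)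
    exact (measure_mono Iio_subset_Iic_self).trans_lt (N.events_Iic_lt_top c p.2 p.1)
  have hBfin : ∀ n, N.campbell P c (B n) < ∞ := fun n => by
    rw [← lintegral_indicator_one (hFp _ (hBm n)), lintegral_campbell _ _
      ((measurable_one).indicator (hFp _ (hBm n)))]
    have : ∀ᵐ ω ∂P, ∫⁻ s, (B n).indicator 1 (s, ω) ∂(N.events c ω) ≤ n + 1 := by
      filter_upwards [hs.events_singleton_le c] with ω hω
      refine le_trans (le_of_eq ?_) (measure_setOf_measure_Iio_lt_le (N.events c ω) hω n)
      exact lintegral_indicator_one (measurable_prodMk_right (hFp _ (hBm n)))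
    refine (lintegral_mono_ae this).trans_lt ?_
    rw [lintegral_const, measure_univ, mul_one]
    finiteness
  -- Both measures are compared on the enlarged predictable σ-algebra only; on all of the product
  -- they differ in general.
  have key : (N.campbell P c).trim hle = (compensator P (lam c)).trim hle := by
    rw [Measure.ext_iff_of_iUnion_eq_univ hBU]
    intro n
    have hBs : MeasurableSet[F.predictable ⊔ K.comap Prod.snd] (B n) :=
      (le_sup_left : F.predictable ≤ _) _ (hBm n)
    have hval : ∀ D, MeasurableSet[F.predictable] D → ∀ E, MeasurableSet[K] E →
        ((N.campbell P c).trim hle).restrict (B n) (D ∩ Prod.snd ⁻¹' E) =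
        ((compensator P (lam c)).trim hle).restrict (B n) (D ∩ Prod.snd ⁻¹' E) := by
      intro D hD E hE
      have hDE : MeasurableSet[F.predictable ⊔ K.comap Prod.snd] (D ∩ Prod.snd ⁻¹' E) :=
        ((le_sup_left : F.predictable ≤ _) _ hD).inter
          ((le_sup_right : _ ≤ F.predictable ⊔ K.comap Prod.snd) _ ⟨E, hE, rfl⟩)
      have hDB : MeasurableSet (D ∩ B n ∩ Prod.snd ⁻¹' E) := by
        rw [inter_right_comm]; exact hle _ (hDE.inter hBs)
      rw [Measure.restrict_apply hDE, Measure.restrict_apply hDE,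
        trim_measurableSet_eq hle (hDE.inter hBs), trim_measurableSet_eq hle (hDE.inter hBs),
        inter_right_comm, ← lintegral_indicator_one hDB, ← lintegral_indicator_one hDB,
        lintegral_campbell _ _ (measurable_one.indicator hDB),
        lintegral_compensator hl (measurable_one.indicator hDB)]
      exact lintegral_compensation_indicator_of_indep hF hH hK hHK hN c (hD.inter (hBm n)) hE
    have : IsFiniteMeasure (((N.campbell P c).trim hle).restrict (B n)) := ⟨by
      rw [Measure.restrict_apply_univ, trim_measurableSet_eq hle hBs]
      exact hBfin n⟩
    refine ext_of_generate_finite _ (sup_eq_generateFrom_inter _ _)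
      (isPiSystem_inter_measurableSet _ _) ?_ ?_
    · rintro _ ⟨D, _, hD, ⟨E, hE, rfl⟩, rfl⟩
      exact hval D hD E hE
    -- Equality of total masses is the case `D = E = univ`, so finiteness is needed only on the
    -- Campbell side.
    · simpa using hval univ MeasurableSet.univ univ MeasurableSet.univ
  have hZm := hZ.mono hle le_rfl
  rw [← lintegral_campbell _ _ hZm, ← lintegral_compensator hl hZm, ← lintegral_trim hle hZ, key,
    lintegral_trim hle hZ]

end CountingProcess

/-! ### Superposition of independent processes -/

namespace CountingProcess

variable {Ω : Type*} {mΩ : MeasurableSpace Ω} {C M : ℕ} {P : Measure Ω}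

/-- The σ-algebra generated by the whole path of the process. -/
abbrev totalHistory (N : CountingProcess Ω C) : MeasurableSpace Ω :=
  MeasurableSpace.pi.comap fun ω c t => N.count c t ω

theorem totalHistory_le (N : CountingProcess Ω C) : N.totalHistory ≤ mΩ := by
  rw [totalHistory, ← measurable_iff_comap_le]
  exact measurable_pi_lambda _ fun c => measurable_pi_lambda _ fun t => N.measurable_count c t

theorem measurable_count_totalHistory (N : CountingProcess Ω C) (c : Fin C) (t : ℝ≥0) :
    Measurable[N.totalHistory] (N.count c t) :=
  (measurable_pi_apply t).comp ((measurable_pi_apply c).comp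
    (comap_measurable fun ω c t => N.count c t ω))

theorem history_le_totalHistory (N : CountingProcess Ω C) (t : ℝ≥0) :
    N.history t ≤ N.totalHistory :=
  N.history_le fun c s _ => N.measurable_count_totalHistory c s

/-- The σ-algebra generated by the paths of all the processes except the `m`-th. -/
abbrev othersHistory (N : Fin M → CountingProcess Ω C) (m : Fin M) : MeasurableSpace Ω :=
  ⨆ k ∈ ({m}ᶜ : Set (Fin M)), (N k).totalHistory

theorem othersHistory_le (N : Fin M → CountingProcess Ω C) (m : Fin M) :
    othersHistory N m ≤ mΩ :=
  iSup₂_le fun k _ => (N k).totalHistory_le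

theorem totalHistory_le_othersHistory (N : Fin M → CountingProcess Ω C) {m k : Fin M}
    (h : k ≠ m) : (N k).totalHistory ≤ othersHistory N m :=
  le_iSup₂_of_le (f := fun k (_ : k ∈ ({m}ᶜ : Set (Fin M))) => (N k).totalHistory) k h le_rfl

theorem indep_totalHistory_othersHistory {N : Fin M → CountingProcess Ω C}
    (hindep : iIndepFun (fun m ω => fun (c : Fin C) (t : ℝ≥0) => (N m).count c t ω) P)
    (m : Fin M) : Indep (N m).totalHistory (othersHistory N m) P := by
  have h := indep_iSup_of_disjoint (fun k => (N k).totalHistory_le)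
    (iIndepFun_iff_iIndep .. |>.1 hindep) (disjoint_compl_right (a := ({m} : Set (Fin M))))
  rwa [iSup_singleton] at h

/-- The other processes enter through their whole paths, future included; this costs nothing, as
they are independent of the `m`-th. -/
theorem joint_history_le (N : Fin M → CountingProcess Ω C) (m : Fin M) :
    ⨆ k, (N k).history ≤
      (N m).history ⊔ Filtration.const ℝ≥0 (othersHistory N m) (othersHistory_le N m) := by
  refine iSup_le fun k => ?_
  rcases eq_or_ne k m with rfl | h
  · exact le_sup_left
  · refine le_trans (fun t => ?_) le_sup_right
    exact ((N k).history_le_totalHistory t).trans (totalHistory_le_othersHistory N h)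

theorem history_superposition_le (N : Fin M → CountingProcess Ω C) :
    (superposition N).history ≤ ⨆ k, (N k).history := fun t =>
  (superposition N).history_le fun c _ hs => by
    let := (⨆ k, (N k).history) t
    exact Finset.measurable_sum Finset.univ fun m _ =>
      ((N m).measurable_count_history c hs).mono (le_iSup (fun k => (N k).history) m t) le_rfl

variable {N : Fin M → CountingProcess Ω C} {lam : Fin M → Fin C → ℝ≥0 → Ω → ℝ≥0∞}

theorem countable_setOf_events_singleton_ne_zero (N : CountingProcess Ω C) (c : Fin C) (ω : Ω) :
    {t | N.events c ω {t} ≠ 0}.Countable := by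
  refine (N.path c ω).countable_leftLim_ne.mono fun t ht => ?_
  refine fun h : Function.leftLim (N.path c ω) t = N.path c ω t => ht ?_
  rw [events, StieltjesFunction.measure_singleton, h, sub_self, ENNReal.ofReal_zero]

/-- The jump at a variable time is the integral of the indicator of the diagonal, which gives joint
measurability. -/
theorem measurable_events_singleton (N : CountingProcess Ω C) (c : Fin C) :
    Measurable[NNReal.measurableSpace.prod N.totalHistory]
      fun p : ℝ≥0 × Ω => N.events c p.2 {p.1} := by
  let := NNReal.measurableSpace.prod N.totalHistory
  have h : Measurable fun p : ℝ≥0 × Ω =>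
      ∫⁻ u, ({q : (ℝ≥0 × Ω) × ℝ≥0 | q.2 = q.1.1}.indicator 1 (p, u) : ℝ≥0∞) ∂(N.events c p.2) := by
    refine N.measurable_lintegral_events (j := Prod.snd)
      (f := fun p u => {q : (ℝ≥0 × Ω) × ℝ≥0 | q.2 = q.1.1}.indicator 1 (p, u)) (fun t => ?_) ?_
    · exact (N.measurable_count_totalHistory c t).comp
        (@measurable_snd _ _ NNReal.measurableSpace N.totalHistory)
    · have hfst : Measurable fun p : ℝ≥0 × Ω => p.1 :=
        @measurable_fst _ _ NNReal.measurableSpace N.totalHistory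
      exact (measurable_const (a := (1 : ℝ≥0∞))).indicator
        (measurableSet_eq_fun measurable_snd (hfst.comp measurable_fst))
  convert h using 2 with p
  exact (lintegral_indicator_one (measurableSet_singleton p.1)).symm

/-- Independent counting processes with conditional intensities have no common jumps. -/
theorem ae_events_singleton_eq_zero_or [IsProbabilityMeasure P]
    (hindep : iIndepFun (fun m ω => fun (c : Fin C) (t : ℝ≥0) => (N m).count c t ω) P)
    {m k : Fin M} (hmk : k ≠ m) (hs : (N m).IsSimple P)
    (hN : (N m).HasIntensity P (N m).history (lam m)) (c c' : Fin C) :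
    ∀ᵐ ω ∂P, ∀ t, (N m).events c ω {t} = 0 ∨ (N k).events c' ω {t} = 0 := by
  set Z : ℝ≥0 × Ω → ℝ≥0∞ := fun p => (N k).events c' p.2 {p.1}
  have hZk := (N k).measurable_events_singleton c'
  have hZ : Measurable[(N m).history.predictable ⊔ (othersHistory N m).comap Prod.snd] Z := by
    refine hZk.mono (le_trans ?_ (prod_le_predictable_sup _ _)) le_rfl
    exact sup_le_sup_left
      (MeasurableSpace.comap_mono (totalHistory_le_othersHistory N hmk)) _
  have hZm : Measurable Z := hZk.mono
    (sup_le_sup_left (MeasurableSpace.comap_mono (N k).totalHistory_le) _) le_rfl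
  have h := lintegral_compensation_of_indep (N m).history_le_totalHistory (N m).totalHistory_le
    (othersHistory_le N m) (indep_totalHistory_othersHistory hindep m) hN hs c hZ
  -- Each path of `N k` has countably many jump times, a Lebesgue-null set.
  have h0 : ∀ ω, ∫⁻ s, Z (s, ω) * lam m c s ω ∂lebesgue = 0 := fun ω => by
    rw [← lintegral_zero (μ := lebesgue)]
    refine lintegral_congr_ae ?_
    refine measure_mono_null (fun s hs => ?_) (lebesgue_eq_zero_of_countable
      ((N k).countable_setOf_events_singleton_ne_zero c' ω))
    exact fun hz => hs (by simp [Z, hz])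
  simp_rw [h0, lintegral_zero] at h
  rw [lintegral_eq_zero_iff ((N m).measurable_lintegral_events_swap c hZm)] at h
  filter_upwards [h] with ω hω t
  have ht : Z (t, ω) * (N m).events c ω {t} ≤ 0 := by
    rw [← lintegral_singleton (fun s => Z (s, ω))]
    exact (setLIntegral_le_lintegral _ _).trans_eq hω
  exact (mul_eq_zero.1 (le_antisymm ht zero_le)).symm

/-- At any time at most one of the processes jumps, and its own simplicity bounds the total jump. -/
theorem isSimple_superposition [IsProbabilityMeasure P]
    (hindep : iIndepFun (fun m ω => fun (c : Fin C) (t : ℝ≥0) => (N m).count c t ω) P)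
    (hs : ∀ m, (N m).IsSimple P)
    (hN : ∀ m, (N m).HasIntensity P (N m).history (lam m)) :
    (superposition N).IsSimple P := by
  have h : ∀ᵐ ω ∂P, ∀ m k, k ≠ m → ∀ c c' t,
      (N m).events c ω {t} = 0 ∨ (N k).events c' ω {t} = 0 := by
    simp_rw [ae_all_iff]
    intro m k hmk c c'
    exact ae_events_singleton_eq_zero_or hindep hmk (hs m) (hN m) c c'
  filter_upwards [h, ae_all_iff.2 hs] with ω hω hsω t
  simp_rw [events_superposition, Measure.finsetSum_apply]
  rw [Finset.sum_comm]
  by_cases h0 : ∃ m c, (N m).events c ω {t} ≠ 0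
  · obtain ⟨m, c, hm⟩ := h0
    rw [Finset.sum_eq_single_of_mem m (Finset.mem_univ m) fun k _ hk =>
      Finset.sum_eq_zero fun c' _ => (hω m k hk c c' t).resolve_left hm]
    exact hsω m t
  · push Not at h0
    simp [h0]

/-- The intensity of a superposition of independent processes with respect to the joint history is
the sum of the intensities. -/
theorem hasIntensity_superposition [IsProbabilityMeasure P]
    (hindep : iIndepFun (fun m ω => fun (c : Fin C) (t : ℝ≥0) => (N m).count c t ω) P)
    (hs : ∀ m, (N m).IsSimple P)
    (hN : ∀ m, (N m).HasIntensity P (N m).history (lam m)) :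
    (superposition N).HasIntensity P (⨆ m, (N m).history) (fun c t ω => ∑ m, lam m c t ω) where
  adapted c t := ((superposition N).measurable_count_history c le_rfl).mono
    (history_superposition_le N t) le_rfl
  predictable c := by
    let := (⨆ m, (N m).history).predictable
    exact Finset.measurable_sum Finset.univ fun m _ => ((hN m).predictable c).mono
      (predictable_mono (le_iSup (fun m => (N m).history) m)) le_rfl
  locally_integrable c := by
    filter_upwards [ae_all_iff.2 fun m => (hN m).locally_integrable c] with ω hω t
    have hm : ∀ m, Measurable fun s => lam m c s ω := fun m =>
      (((hN m).predictable c).mono (predictable_le_measurableSpace_prod _) le_rfl).comp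
        measurable_prodMk_right
    rw [lintegral_finsetSum _ fun m _ => hm m]
    exact ENNReal.sum_lt_top.2 fun m _ => hω m t
  compensation c Z hZ := by
    have hZm := hZ.mono (predictable_le_measurableSpace_prod _) le_rfl
    have hlm : ∀ m, Measurable fun p : ℝ≥0 × Ω => lam m c p.1 p.2 := fun m =>
      ((hN m).predictable c).mono (predictable_le_measurableSpace_prod _) le_rfl
    simp_rw [events_superposition, lintegral_finsetSum_measure, Finset.mul_sum]
    rw [lintegral_finsetSum _ fun m _ => (N m).measurable_lintegral_events_swap c hZm]
    have hr : ∀ ω, ∫⁻ s, ∑ m, Z (s, ω) * lam m c s ω ∂lebesgue =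
        ∑ m, ∫⁻ s, Z (s, ω) * lam m c s ω ∂lebesgue := fun ω =>
      lintegral_finsetSum _ fun m _ => (hZm.mul (hlm m)).comp measurable_prodMk_right
    simp_rw [hr]
    rw [lintegral_finsetSum _ fun m _ => measurable_lintegral_lebesgue
      (Z := fun p => Z p * lam m c p.1 p.2) (hZm.mul (hlm m))]
    refine Finset.sum_congr rfl fun m _ => ?_
    exact lintegral_compensation_of_indep (N m).history_le_totalHistory (N m).totalHistory_le
      (othersHistory_le N m) (indep_totalHistory_othersHistory hindep m) (hN m) (hs m) c
      (hZ.mono (predictable_le_sup (joint_history_le N m)) le_rfl)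

/-- An intensity with respect to a larger filtration is an intensity with respect to any smaller
one for which it is predictable. -/
theorem HasIntensity.mono {N : CountingProcess Ω C} {F F' : Filtration ℝ≥0 mΩ}
    {l : Fin C → ℝ≥0 → Ω → ℝ≥0∞} (h : N.HasIntensity P F l) (hF : F' ≤ F)
    (hN : ∀ c t, Measurable[F' t] (N.count c t))
    (hl : ∀ c, Measurable[F'.predictable] fun p : ℝ≥0 × Ω => l c p.1 p.2) :
    N.HasIntensity P F' l where
  adapted := hN
  predictable := hl
  locally_integrable := h.locally_integrable
  compensation c Z hZ := h.compensation c Z (hZ.mono (predictable_mono hF) le_rfl)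

end CountingProcess

end HawkesProcess

end

theorem theorem2 {Ω : Type*} [MeasurableSpace Ω] (P : Measure Ω) [IsProbabilityMeasure P]
    (C L M : ℕ) (g : Fin L → ℝ≥0 → ℝ≥0) (hg : ∀ l, Measurable (g l))
    (μ : Fin M → Fin C → ℝ≥0) (A : Fin C → Fin C → Fin L → ℝ≥0)
    (N : Fin M → HawkesProcess.CountingProcess Ω C)
    (hN : ∀ m, HawkesProcess.IsHawkes P g (μ m) A (N m))
    (hindep : iIndepFun (fun m ω => fun (c : Fin C) (t : ℝ≥0) => (N m).count c t ω) P) :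
    HawkesProcess.IsHawkes P g (fun c => ∑ m, μ m c) A
        (HawkesProcess.CountingProcess.superposition N) ∧
      (HawkesProcess.CountingProcess.superposition N).HasIntensity P (⨆ m, (N m).history)
        (fun c t ω => ∑ m, HawkesProcess.intensity g (μ m) A (N m) c t ω) := by
  have hs := fun m => (hN m).simple
  have hI := HawkesProcess.CountingProcess.hasIntensity_superposition hindep hs
    fun m => (hN m).hasIntensity
  refine ⟨⟨HawkesProcess.CountingProcess.isSimple_superposition hindep hs
    fun m => (hN m).hasIntensity, ?_⟩, hI⟩
  have hadapted := fun c t =>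
    (HawkesProcess.CountingProcess.superposition N).measurable_count_history c (le_refl t)
  have heq : HawkesProcess.intensity g (fun c => ∑ m, μ m c) A
      (HawkesProcess.CountingProcess.superposition N) =
      fun c t ω => ∑ m, HawkesProcess.intensity g (μ m) A (N m) c t ω := by
    ext c t ω
    exact HawkesProcess.intensity_superposition g μ A N c t ω
  -- Passing to the smaller history only removes test processes; what needs proof is that the
  -- intensity is predictable for it.
  refine HawkesProcess.CountingProcess.HasIntensity.mono (heq ▸ hI)
    (HawkesProcess.CountingProcess.history_superposition_le N) hadapted ?_
  exact HawkesProcess.measurable_predictable_intensity hg _ A _ hadapted
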